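/- Let $\Lambda_2$ be the graph with vertex set $\mathbb{Z}^2$ in which two vertices are adjacent if and only if their Euclidean distance is $1$. For a graph $\Gamma=(V,E)$ with graph distance $d$ and an integer $t\ge 1$, a set $S\subseteq V$ is called a $t$-perfect distance-dominating set ($t$-PDDS) in $\Gamma$ if for each $v\in V$ there is a unique connected component $C_v$ of the subgraph $[S]$ induced by $S$ such that $d(v,C_v)\le t$, where $d(v,C_v)=\min\{d(v,w): w\in C_v\}$, and there is in $C_v$ a unique vertex $w$ with $d(v,w)=d(v,C_v)$. For a finite graph $H$, a $t$-PDDS$[H]$ is a $t$-PDDS such that every component of $[S]$ is isomorphic to $H$. Let $P_k$ denote the path on $k$ vertices and $\square$ the Cartesian product of graphs. For every finite graph $H$ and every integer $t\ge 1$: a $t$-PDDS$[H]$ in $\Lambda_2$ exists if and only if $H$ is isomorphic to $P_k$ for some $k\ge 1$, or to $P_2\square P_k$ for some $k\ge 2$. -/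

import Mathlib

open SimpleGraph

/-- The graph `Λ_n`: vertex set `ℤⁿ`, two vertices being adjacent if and only if their
Euclidean distance is `1` (equivalently, its square `∑ (xᵢ - yᵢ)²` is `1`). -/
def latticeGraph (n : ℕ) : SimpleGraph (Fin n → ℤ) where
  Adj x y := ∑ i, (x i - y i) ^ 2 = 1
  symm := ⟨fun x y h => by
    rw [← h]
    exact Finset.sum_congr rfl fun i _ => by ring⟩
  loopless := ⟨fun x h => by simp at h⟩

/-- The distance `d(v, A) = min {d(v, w) : w ∈ A}` from a vertex `v` to a set `A` of vertices
(it is `⊤` if no vertex of `A` can be reached from `v`). -/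
noncomputable def vertexSetDist {V : Type*} (Γ : SimpleGraph V) (v : V) (A : Set V) : ℕ∞ :=
  ⨅ w ∈ A, Γ.edist v w

/-- The vertices, in the ambient graph, of a component of the subgraph `[S]` induced by `S`. -/
def componentVerts {V : Type*} {Γ : SimpleGraph V} {S : Set V}
    (C : (Γ.induce S).ConnectedComponent) : Set V :=
  Subtype.val '' C.supp

/-- `S` is a `t`-perfect distance-dominating set in `Γ`: for each vertex `v` there is exactly one
component `C` of `[S]` with `d(v, C) ≤ t`, and in this `C` there is exactly one vertex `w` with
`d(v, w) = d(v, C)`. -/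
def IsPDDS {V : Type*} (t : ℕ) (Γ : SimpleGraph V) (S : Set V) : Prop :=
  ∀ v : V, ∃ C : (Γ.induce S).ConnectedComponent,
    (vertexSetDist Γ v (componentVerts C) ≤ t ∧
      ∀ C' : (Γ.induce S).ConnectedComponent,
        vertexSetDist Γ v (componentVerts C') ≤ t → C' = C) ∧
    ∃! w : V, w ∈ componentVerts C ∧ Γ.edist v w = vertexSetDist Γ v (componentVerts C)

/-- `S` is a `t`-PDDS`[H]` in `Γ`: a `t`-PDDS for which every component of `[S]` is isomorphic
to `H`. -/
def IsPDDSOf {V W : Type*} (t : ℕ) (H : SimpleGraph W) (Γ : SimpleGraph V) (S : Set V) : Prop :=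
  IsPDDS t Γ S ∧
    ∀ C : (Γ.induce S).ConnectedComponent, Nonempty (Γ.induce (componentVerts C) ≃g H)

/-! Graph distance in `Λ_2` is taxicab distance. A vertex outside a component with two neighbours in
it would have two nearest points there, so a component contains the corner of each of its
`L`-shapes; being finite and connected, it is a rectangle (`eq_latticeBox_of_corner_closed`). A
`t`-PDDS with finite components thus amounts to a partition of `ℤ²` into radius-`t` neighbourhoods
of rectangles (`BoxTiling`); conversely, nearest points in a rectangle are always unique.

It remains to see which rectangles tile. For side lengths `1 × k` and `2 × k` there are explicit
lattice tilings (`boxTiling_segment`, `boxTiling_strip`). If all sides are at least `2` and some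
rectangle has both sides at least `3`, the staircase at its lower left corner forces two distinct
rectangles to within distance `2t` of each other, which is impossible (`not_three_le`). -/

/-- The taxicab distance on `ℤ²`. -/
def taxi (v w : Fin 2 → ℤ) : ℕ := (v 0 - w 0).natAbs + (v 1 - w 1).natAbs

lemma latticeGraph_two_adj {v w : Fin 2 → ℤ} : (latticeGraph 2).Adj v w ↔ taxi v w = 1 := by
  show ∑ i, (v i - w i) ^ 2 = 1 ↔ _
  rw [Fin.sum_univ_two, taxi]
  generalize v 0 - w 0 = d
  generalize v 1 - w 1 = e
  constructor
  · intro h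
    have h1 : d ≤ 1 := by nlinarith [sq_nonneg e]
    have h2 : -1 ≤ d := by nlinarith [sq_nonneg e]
    have h3 : e ≤ 1 := by nlinarith [sq_nonneg d]
    have h4 : -1 ≤ e := by nlinarith [sq_nonneg d]
    interval_cases d <;> interval_cases e <;> simp_all
  · intro h
    have h1 : d ≤ 1 := by omega
    have h2 : -1 ≤ d := by omega
    have h3 : e ≤ 1 := by omega
    have h4 : -1 ≤ e := by omega
    interval_cases d <;> interval_cases e <;> simp_all

lemma taxi_le_length {v w : Fin 2 → ℤ} (p : (latticeGraph 2).Walk v w) :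
    taxi v w ≤ p.length := by
  induction p with
  | nil => simp [taxi]
  | cons h p ih =>
    rw [latticeGraph_two_adj] at h
    rw [Walk.length_cons]
    unfold taxi at *
    omega

lemma eq_of_taxi_eq_zero {v w : Fin 2 → ℤ} (h : taxi v w = 0) : v = w := by
  unfold taxi at h
  ext i
  fin_cases i
  · show v 0 = w 0
    omega
  · show v 1 = w 1
    omega

lemma exists_walk_length_eq_taxi (v w : Fin 2 → ℤ) :
    ∃ p : (latticeGraph 2).Walk v w, p.length = taxi v w := by
  obtain ⟨n, hn⟩ : ∃ n, taxi v w = n := ⟨_, rfl⟩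
  induction n generalizing v with
  | zero =>
    obtain rfl := eq_of_taxi_eq_zero hn
    exact ⟨Walk.nil, by simp [hn]⟩
  | succ n ih =>
    obtain ⟨u, hu, hw⟩ : ∃ u, taxi v u = 1 ∧ taxi u w = n := by
      unfold taxi at hn
      rcases lt_trichotomy (v 0) (w 0) with h | h | h
      · exact ⟨![v 0 + 1, v 1], by simp [taxi], by simp [taxi]; omega⟩
      · rcases lt_or_ge (v 1) (w 1) with h' | h'
        · exact ⟨![v 0, v 1 + 1], by simp [taxi], by simp [taxi]; omega⟩
        · exact ⟨![v 0, v 1 - 1], by simp [taxi], by simp [taxi]; omega⟩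
      · exact ⟨![v 0 - 1, v 1], by simp [taxi], by simp [taxi]; omega⟩
    obtain ⟨p, hp⟩ := ih u hw
    exact ⟨Walk.cons (latticeGraph_two_adj.2 hu) p, by rw [Walk.length_cons, hp, hw, hn]⟩

lemma edist_latticeGraph_two (v w : Fin 2 → ℤ) : (latticeGraph 2).edist v w = taxi v w := by
  apply le_antisymm
  · obtain ⟨p, hp⟩ := exists_walk_length_eq_taxi v w
    exact hp ▸ Walk.edist_le p
  · exact le_iInf fun p => Nat.cast_le.2 (taxi_le_length p)

lemma vertexSetDist_le_iff {v : Fin 2 → ℤ} {A : Set (Fin 2 → ℤ)} {t : ℕ} :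
    vertexSetDist (latticeGraph 2) v A ≤ t ↔ ∃ w ∈ A, taxi v w ≤ t := by
  constructor
  · intro h
    by_contra! hA
    have : ((t + 1 : ℕ) : ℕ∞) ≤ vertexSetDist (latticeGraph 2) v A := by
      refine le_iInf₂ fun w hw => ?_
      rw [edist_latticeGraph_two]
      exact Nat.cast_le.2 (hA w hw)
    have := Nat.cast_le.1 (this.trans h)
    omega
  · rintro ⟨w, hw, h⟩
    refine iInf₂_le_of_le w hw ?_
    rw [edist_latticeGraph_two]
    exact Nat.cast_le.2 h

lemma edist_eq_vertexSetDist_iff {v w : Fin 2 → ℤ} {A : Set (Fin 2 → ℤ)} (hw : w ∈ A) :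
    (latticeGraph 2).edist v w = vertexSetDist (latticeGraph 2) v A ↔
      ∀ u ∈ A, taxi v w ≤ taxi v u := by
  constructor
  · intro h u hu
    have : (latticeGraph 2).edist v w ≤ (latticeGraph 2).edist v u := h ▸ iInf₂_le u hu
    rw [edist_latticeGraph_two, edist_latticeGraph_two] at this
    exact Nat.cast_le.1 this
  · intro h
    apply le_antisymm
    · refine le_iInf₂ fun u hu => ?_
      rw [edist_latticeGraph_two, edist_latticeGraph_two]
      exact Nat.cast_le.2 (h u hu)
    · exact iInf₂_le w hw

/-! ### Rectangles of lattice points and corner-closed sets. -/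

/-- The set of lattice points of the rectangle `[a, b] × [c, d]`. -/
def latticeBox (a b c d : ℤ) : Set (Fin 2 → ℤ) :=
  {v | (a ≤ v 0 ∧ v 0 ≤ b) ∧ c ≤ v 1 ∧ v 1 ≤ d}

lemma mem_latticeBox {a b c d : ℤ} {v : Fin 2 → ℤ} :
    v ∈ latticeBox a b c d ↔ (a ≤ v 0 ∧ v 0 ≤ b) ∧ c ≤ v 1 ∧ v 1 ≤ d := Iff.rfl

/-- A rectangle of lattice points induces a product of two paths. -/
def latticeBoxIso {a b c d : ℤ} {m n : ℕ} (hm : b + 1 - a = m) (hn : d + 1 - c = n) :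
    (latticeGraph 2).induce (latticeBox a b c d) ≃g pathGraph m □ pathGraph n where
  toFun v := (⟨(v.1 0 - a).toNat, by have := mem_latticeBox.1 v.2; omega⟩,
    ⟨(v.1 1 - c).toNat, by have := mem_latticeBox.1 v.2; omega⟩)
  invFun p := ⟨![a + p.1, c + p.2], by
    have := p.1.2
    have := p.2.2
    simp only [mem_latticeBox, Matrix.cons_val_zero, Matrix.cons_val_one]
    omega⟩
  left_inv v := by
    have := mem_latticeBox.1 v.2
    ext i
    fin_cases i <;> simp <;> omega
  right_inv p := by
    ext <;> simp
  map_rel_iff' {v w} := by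
    have := mem_latticeBox.1 v.2
    have := mem_latticeBox.1 w.2
    simp only [Equiv.coe_fn_mk, boxProd_adj, pathGraph_adj, Fin.ext_iff, comap_adj,
      Function.Embedding.subtype_apply, latticeGraph_two_adj, taxi]
    omega

lemma connected_induce_latticeBox {a b c d : ℤ} (hab : a ≤ b) (hcd : c ≤ d) :
    ((latticeGraph 2).induce (latticeBox a b c d)).Connected := by
  obtain ⟨m, hm⟩ : ∃ m : ℕ, b + 1 - a = (m + 1 : ℕ) := ⟨(b - a).toNat, by omega⟩
  obtain ⟨n, hn⟩ : ∃ n : ℕ, d + 1 - c = (n + 1 : ℕ) := ⟨(d - c).toNat, by omega⟩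
  exact (latticeBoxIso hm hn).connected_iff.2
    ((pathGraph_connected m).boxProd (pathGraph_connected n))

/-- The product of a graph with the one-vertex path is the graph itself. -/
def boxProdPathGraphOne {V : Type*} (G : SimpleGraph V) :
    G.boxProd (pathGraph 1) ≃g G where
  toEquiv := Equiv.prodUnique V (Fin 1)
  map_rel_iff' {p q} := by
    have h1 : p.2 = q.2 := Subsingleton.elim _ _
    simp [boxProd_adj, h1]

section Fill

variable {P : ℤ → ℤ → Prop}

/-- Next to a full row, one point of the adjacent row spreads along it: each new point is the corner
of an `L` formed by its predecessor and its neighbour in the full row. -/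
lemma fill_segment
    (hP : ∀ x y x' y', (x' - x).natAbs = 1 → (y' - y).natAbs = 1 → P x' y → P x y' → P x y)
    {a b x y y' : ℤ} (hy : (y' - y).natAbs = 1) (hx : a ≤ x) (hx' : x ≤ b) (h : P x y)
    (hrow : ∀ z, a ≤ z → z ≤ b → P z y') (z : ℤ) (hz : a ≤ z) (hz' : z ≤ b) : P z y := by
  obtain ⟨n, hn⟩ : ∃ n, (z - x).natAbs = n := ⟨_, rfl⟩
  induction n generalizing z with
  | zero =>
    obtain rfl : z = x := by omega
    exact h
  | succ n ih =>
    rcases lt_or_ge z x with hzx | hzx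
    · exact hP z y (z + 1) y' (by omega) hy (ih (z + 1) (by omega) (by omega) (by omega))
        (hrow z hz hz')
    · exact hP z y (z - 1) y' (by omega) hy (ih (z - 1) (by omega) (by omega) (by omega))
        (hrow z hz hz')

end Fill

/-- A finite nonempty connected set of lattice points which contains the corners of each of its
`L`-shapes is a rectangle. -/
lemma eq_latticeBox_of_corner_closed {A : Set (Fin 2 → ℤ)} (hfin : A.Finite) (hne : A.Nonempty)
    (hconn : ∀ R ⊆ A, R.Nonempty → R ≠ A → ∃ u ∈ R, ∃ v ∈ A, v ∉ R ∧ taxi u v = 1)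
    (hclosed : ∀ x y x' y', (x' - x).natAbs = 1 → (y' - y).natAbs = 1 →
      ![x', y] ∈ A → ![x, y'] ∈ A → ![x, y] ∈ A) :
    ∃ a b c d : ℤ, a ≤ b ∧ c ≤ d ∧ A = latticeBox a b c d := by
  -- A maximal rectangle inside `A` is all of `A`: otherwise some point of `A` touches one of its
  -- sides, and `fill_segment` adds the whole adjacent row or column.
  let T : Set (Set (Fin 2 → ℤ)) :=
    {R | R ⊆ A ∧ ∃ a b c d : ℤ, a ≤ b ∧ c ≤ d ∧ R = latticeBox a b c d}
  have hT : T.Finite := hfin.finite_subsets.subset fun R hR => hR.1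
  obtain ⟨v₀, hv₀⟩ := hne
  have hTne : T.Nonempty := by
    refine ⟨latticeBox (v₀ 0) (v₀ 0) (v₀ 1) (v₀ 1), ?_, _, _, _, _, le_rfl, le_rfl, rfl⟩
    intro v hv
    rw [mem_latticeBox] at hv
    rwa [eq_of_taxi_eq_zero (v := v) (w := v₀) (by unfold taxi; omega)]
  obtain ⟨R, ⟨hRA, a, b, c, d, hab, hcd, rfl⟩, hmax⟩ := hT.exists_maximal hTne
  refine ⟨a, b, c, d, hab, hcd, ?_⟩
  by_contra hAR
  have eta (v : Fin 2 → ℤ) : ![v 0, v 1] = v := by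
    ext i
    fin_cases i <;> rfl
  have hbox (x y : ℤ) (h1 : a ≤ x) (h2 : x ≤ b) (h3 : c ≤ y) (h4 : y ≤ d) : ![x, y] ∈ A :=
    hRA (by simp [mem_latticeBox, *])
  have hext (a' b' c' d' : ℤ) (ha : a' ≤ a) (hb : b ≤ b') (hc : c' ≤ c) (hd : d ≤ d')
      (hsub : ∀ x y, a' ≤ x → x ≤ b' → c' ≤ y → y ≤ d' →
        ![x, y] ∈ A) : a' = a ∧ b' = b ∧ c' = c ∧ d' = d := by
    have h := hmax (y := latticeBox a' b' c' d')
      ⟨fun v hv => eta v ▸ hsub _ _ hv.1.1 hv.1.2 hv.2.1 hv.2.2,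
        a', b', c', d', by omega, by omega, rfl⟩
      (fun v hv => by rw [mem_latticeBox] at *; omega)
    have h1 := @h ![a', c'] (by simp [mem_latticeBox]; omega)
    have h2 := @h ![b', d'] (by simp [mem_latticeBox]; omega)
    simp [mem_latticeBox] at h1 h2
    omega
  obtain ⟨u, hu, v, hvA, hvR, huv⟩ := hconn _ hRA
    ⟨![a, c], by simp [mem_latticeBox, hab, hcd]⟩ (Ne.symm hAR)
  rw [← eta v] at hvA
  rw [mem_latticeBox] at hu hvR
  unfold taxi at huv
  have hrow (hv : a ≤ v 0 ∧ v 0 ≤ b) (x : ℤ) (h1 : a ≤ x) (h2 : x ≤ b) : ![x, v 1] ∈ A :=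
    fill_segment (P := fun x y => ![x, y] ∈ A) hclosed (y' := u 1) (by omega) hv.1 hv.2 hvA
      (fun z h1 h2 => hbox z _ h1 h2 hu.2.1 hu.2.2) x h1 h2
  have hcol (hv : c ≤ v 1 ∧ v 1 ≤ d) (y : ℤ) (h1 : c ≤ y) (h2 : y ≤ d) : ![v 0, y] ∈ A :=
    fill_segment (P := fun y x => ![x, y] ∈ A)
      (fun y x y' x' hy hx h h' => hclosed x y x' y' hx hy h' h)
      (y' := u 0) (by omega) hv.1 hv.2 hvA
      (fun z h1 h2 => hbox _ z hu.1.1 hu.1.2 h1 h2) y h1 h2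
  by_cases hv : a ≤ v 0 ∧ v 0 ≤ b
  · have := hext a b (min c (v 1)) (max d (v 1)) le_rfl le_rfl (by omega) (by omega)
      fun x y h1 h2 h3 h4 => by
        by_cases hy : c ≤ y ∧ y ≤ d
        · exact hbox x y h1 h2 hy.1 hy.2
        · obtain rfl : y = v 1 := by omega
          exact hrow hv x h1 h2
    omega
  · have hv' : c ≤ v 1 ∧ v 1 ≤ d := by omega
    have := hext (min a (v 0)) (max b (v 0)) c d (by omega) (by omega) le_rfl le_rfl
      fun x y h1 h2 h3 h4 => by
        by_cases hx : a ≤ x ∧ x ≤ b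
        · exact hbox x y hx.1 hx.2 h3 h4
        · obtain rfl : x = v 0 := by omega
          exact hcol hv' y h3 h4
    omega

/-! ### Tilings by neighbourhoods of rectangles: the obstruction. -/

/-- The point `(x, y)` is at taxicab distance at most `t` from the rectangle
`[a, b] × [c, d]`. -/
def NearBox (t a b c d x y : ℤ) : Prop :=
  max (max (a - x) (x - b)) 0 + max (max (c - y) (y - d)) 0 ≤ t

lemma nearBox_swap {t a b c d x y : ℤ} : NearBox t a b c d x y ↔ NearBox t c d a b y x := by
  unfold NearBox
  rw [add_comm]

lemma nearBox_reflect {t a b c d x y : ℤ} :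
    NearBox t (-b) (-a) c d (-x) y ↔ NearBox t a b c d x y := by
  unfold NearBox
  rw [neg_sub_neg, neg_sub_neg, max_comm (x - b)]

/-- The neighbourhoods of radius `t` of the rectangles `[a i, b i] × [c i, d i]` partition
`ℤ²`. -/
structure BoxTiling {ι : Type*} (t : ℤ) (a b c d : ι → ℤ) : Prop where
  left_le (i : ι) : a i ≤ b i
  low_le (i : ι) : c i ≤ d i
  exists_near (x y : ℤ) : ∃ i, NearBox t (a i) (b i) (c i) (d i) x y
  unique (x y : ℤ) (i j : ι) : NearBox t (a i) (b i) (c i) (d i) x y →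
    NearBox t (a j) (b j) (c j) (d j) x y → i = j

namespace BoxTiling

variable {ι : Type*} {t : ℤ} {a b c d : ι → ℤ}

lemma swap (h : BoxTiling t a b c d) : BoxTiling t c d a b where
  left_le := h.low_le
  low_le := h.left_le
  exists_near x y := by
    obtain ⟨i, hi⟩ := h.exists_near y x
    exact ⟨i, nearBox_swap.1 hi⟩
  unique x y i j hi hj := h.unique y x i j (nearBox_swap.1 hi) (nearBox_swap.1 hj)

lemma reflect (h : BoxTiling t a b c d) :
    BoxTiling t (fun i => -b i) (fun i => -a i) c d where
  left_le i := neg_le_neg (h.left_le i)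
  low_le := h.low_le
  exists_near x y := by
    obtain ⟨i, hi⟩ := h.exists_near (-x) y
    exact ⟨i, by rwa [← nearBox_reflect, neg_neg] at hi⟩
  unique x y i j hi hj := h.unique (-x) y i j
    (by rwa [← nearBox_reflect, neg_neg]) (by rwa [← nearBox_reflect, neg_neg])

/-- Distinct rectangles of a tiling have distance greater than `2t`. -/
lemma separated (h : BoxTiling t a b c d) {i j : ι} {x y x' y' : ℤ}
    (hx : a i ≤ x ∧ x ≤ b i) (hy : c i ≤ y ∧ y ≤ d i)
    (hx' : a j ≤ x' ∧ x' ≤ b j) (hy' : c j ≤ y' ∧ y' ≤ d j)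
    (hd : (x - x').natAbs + (y - y').natAbs ≤ 2 * t) : i = j := by
  -- The common point is reached from `(x, y)` by at most `t` steps towards `(x', y')`, horizontal
  -- ones first.
  by_cases hxt : (x - x').natAbs ≤ t
  · rcases le_total y y' with hyy | hyy
    · exact h.unique x' (min y' (y + (t - (x - x').natAbs))) i j
        (by unfold NearBox; omega) (by unfold NearBox; omega)
    · exact h.unique x' (max y' (y - (t - (x - x').natAbs))) i j
        (by unfold NearBox; omega) (by unfold NearBox; omega)
  · rcases le_total x x' with hxx | hxx
    · exact h.unique (x + t) y i j (by unfold NearBox; omega) (by unfold NearBox; omega)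
    · exact h.unique (x - t) y i j (by unfold NearBox; omega) (by unfold NearBox; omega)

/-- A point whose right and upper neighbours belong to other tiles lies on the upper right
staircase of its own tile. -/
lemma exists_upper_right_corner (h : BoxTiling t a b c d) {i k : ι} {x y : ℤ}
    (hi : NearBox t (a i) (b i) (c i) (d i) (x + 1) y)
    (hk : NearBox t (a k) (b k) (c k) (d k) x (y + 1))
    (hi' : ¬ NearBox t (a i) (b i) (c i) (d i) x y)
    (hk' : ¬ NearBox t (a k) (b k) (c k) (d k) x y) :
    ∃ j, j ≠ i ∧ j ≠ k ∧ b j ≤ x ∧ d j ≤ y ∧ x - b j + (y - d j) = t := by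
  obtain ⟨j, hj⟩ := h.exists_near x y
  have hji : j ≠ i := by rintro rfl; exact hi' hj
  have hjk : j ≠ k := by rintro rfl; exact hk' hj
  have h1 : ¬ NearBox t (a j) (b j) (c j) (d j) (x + 1) y := fun h' => hji (h.unique _ _ _ _ h' hi)
  have h2 : ¬ NearBox t (a j) (b j) (c j) (d j) x (y + 1) := fun h' => hjk (h.unique _ _ _ _ h' hk)
  have := h.left_le j
  have := h.low_le j
  refine ⟨j, hji, hjk, ?_⟩
  -- Both a step right and a step up leave the neighbourhood of `j`. Hence both steps increase the
  -- distance, and it was already `t`.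
  unfold NearBox at hj h1 h2
  omega

lemma exists_upper_left_corner (h : BoxTiling t a b c d) {i k : ι} {x y : ℤ}
    (hi : NearBox t (a i) (b i) (c i) (d i) (x - 1) y)
    (hk : NearBox t (a k) (b k) (c k) (d k) x (y + 1))
    (hi' : ¬ NearBox t (a i) (b i) (c i) (d i) x y)
    (hk' : ¬ NearBox t (a k) (b k) (c k) (d k) x y) :
    ∃ j, j ≠ i ∧ j ≠ k ∧ x ≤ a j ∧ d j ≤ y ∧ a j - x + (y - d j) = t := by
  obtain ⟨j, hji, hjk, hj⟩ := h.reflect.exists_upper_right_corner (i := i) (k := k)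
    (x := -x) (y := y) (by rwa [neg_add_eq_sub, ← neg_sub, nearBox_reflect])
    (by rwa [nearBox_reflect]) (by rwa [nearBox_reflect]) (by rwa [nearBox_reflect])
  exact ⟨j, hji, hjk, by omega⟩

/-- The point `(a i + 1, c i - t - 1)` lies just below the neighbourhood of `i` and just right of
that of `j`, so it is on the upper left staircase of a third tile `k`. Its corner `(a k, d k)` is at
distance `2t` from `(a i + 2, c i)` if it is level with `d j`, and from `(b j, d j - 1)` if it is
lower. -/
lemma not_adjacent_corner (h : BoxTiling t a b c d) (ht : 1 ≤ t) {i j : ι}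
    (hi : a i + 2 ≤ b i) (hj : c j + 1 ≤ d j) (hx : b j = a i - t) (hy : d j = c i - t - 1) :
    False := by
  have := h.left_le j
  have := h.low_le i
  obtain ⟨k, hkj, hki, h1, h2, h3⟩ := h.exists_upper_left_corner (i := j) (k := i)
    (x := a i + 1) (y := c i - t - 1)
    (by unfold NearBox; omega) (by unfold NearBox; omega) (by unfold NearBox; omega)
    (by unfold NearBox; omega)
  have := h.left_le k
  have := h.low_le k
  by_cases hd : d k = c i - t - 1
  · exact hki (h.separated (x := a k) (y := d k) (x' := a i + 2) (y' := c i)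
      (by omega) (by omega) (by omega) (by omega) (by omega))
  · exact hkj (h.separated (x := a k) (y := d k) (x' := b j) (y' := d j - 1)
      (by omega) (by omega) (by omega) (by omega) (by omega))

/-- The points `(a i - u, c i - (t + 1 - u))` fill the notches of the lower left staircase of `i`:
they are at distance `t + 1` from its corner, while their right and upper neighbours are at distance
`t`. The corners found all lie on one antidiagonal. -/
lemma exists_upper_right_corner_of_notch (h : BoxTiling t a b c d) (i : ι) {u : ℤ}
    (hu : 1 ≤ u) (hut : u ≤ t) :
    ∃ j, j ≠ i ∧ a i - u - t ≤ b j ∧ b j ≤ a i - u ∧ b j + d j = a i + c i - 2 * t - 1 := by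
  have := h.left_le i
  have := h.low_le i
  obtain ⟨j, hji, -, h1, h2, h3⟩ := h.exists_upper_right_corner (i := i) (k := i)
    (x := a i - u) (y := c i - (t + 1 - u))
    (by unfold NearBox; omega) (by unfold NearBox; omega) (by unfold NearBox; omega)
    (by unfold NearBox; omega)
  exact ⟨j, hji, by omega⟩

/-- In a tiling by neighbourhoods of rectangles with both side lengths at least `2`, no
rectangle has both side lengths at least `3`. -/
theorem not_three_le (h : BoxTiling t a b c d) (ht : 1 ≤ t)
    (ha : ∀ j, a j + 1 ≤ b j) (hc : ∀ j, c j + 1 ≤ d j) (i : ι)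
    (hai : a i + 2 ≤ b i) (hci : c i + 2 ≤ d i) : False := by
  obtain ⟨j, hji, h1, h2, h3⟩ := h.exists_upper_right_corner_of_notch i le_rfl ht
  by_cases hb : b j = a i - t
  · exact h.not_adjacent_corner ht hai (hc j) hb (by omega)
  by_cases hb' : b j = a i - t - 1
  · exact h.swap.not_adjacent_corner ht hci (ha j) (by omega) hb'
  -- The notch in column `b j - 1` lies left of the corner of `j`, so it yields another tile `k`
  -- with corner on the same antidiagonal.
  obtain ⟨k, hki, h4, h5, h6⟩ := h.exists_upper_right_corner_of_notch i (u := a i - b j + 1)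
    (by omega) (by omega)
  have := ha j
  have := ha k
  have := hc j
  have := hc k
  have hjk : j ≠ k := by
    rintro rfl
    omega
  -- The corners are `2 (b j - b k)` apart. This exceeds `2t` only for a gap of `t + 1`, and then
  -- moving one step inward in each rectangle brings the distance down to `2t`.
  by_cases hk : b k = b j - 1 - t
  · exact hjk (h.separated (x := b j - 1) (y := d j) (x' := b k) (y' := d k - 1)
      (by omega) (by omega) (by omega) (by omega) (by omega))
  · exact hjk (h.separated (x := b j) (y := d j) (x' := b k) (y' := d k)
      (by omega) (by omega) (by omega) (by omega) (by omega))

end BoxTiling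

/-! ### Explicit tilings. -/

/-- With `g n` the offset of a point from the start of the `n`-th of a sequence of abutting
intervals, this says that exactly one interval contains the point. -/
lemma existsUnique_sign_change {g : ℤ → ℤ} (hg : ∀ n, g (n + 1) < g n) :
    ∃! n, 0 ≤ g n ∧ g (n + 1) < 0 := by
  have hanti : StrictAnti g := strictAnti_int_of_succ_lt hg
  have hup (n : ℕ) : g n ≤ g 0 - n := by
    induction n with
    | zero => simp
    | succ n ih =>
      have := hg n
      push_cast
      omega
  have hdown (n : ℕ) : g 0 + n ≤ g (-n) := by
    induction n with
    | zero => simp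
    | succ n ih =>
      have := hg (-(n + 1 : ℕ))
      rw [show -((n + 1 : ℕ) : ℤ) + 1 = -n by push_cast; ring] at this
      push_cast at *
      omega
  obtain ⟨n, hn, hmax⟩ := Int.exists_greatest_of_bdd (P := fun n => 0 ≤ g n)
    ⟨(g 0).natAbs, fun z hz => by
      by_contra! hlt
      have := hanti hlt
      have := hup (g 0).natAbs
      omega⟩ ⟨-(g 0).natAbs, by have := hdown (g 0).natAbs; omega⟩
  refine ⟨n, ⟨hn, ?_⟩, ?_⟩
  · by_contra! h
    have := hmax _ h
    omega
  · rintro m ⟨hm, hm'⟩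
    apply le_antisymm (hmax m hm)
    by_contra! hlt
    have := hanti.antitone (show m + 1 ≤ n by omega)
    omega

/-- The tiling by neighbourhoods of horizontal segments. -/
lemma boxTiling_segment {t k : ℤ} (ht : 1 ≤ t) (hk : 1 ≤ k) :
    BoxTiling t (fun p : ℤ × ℤ => p.1 + p.2 * (t + k - 1))
      (fun p => p.1 + p.2 * (t + k - 1) + (k - 1))
      (fun p => p.2 * (t + 1) - p.1 * (2 * t + 1))
      (fun p => p.2 * (t + 1) - p.1 * (2 * t + 1)) := by
  have key (x y : ℤ) : ∃! p : ℤ × ℤ, NearBox t (p.1 + p.2 * (t + k - 1))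
      (p.1 + p.2 * (t + k - 1) + (k - 1)) (p.2 * (t + 1) - p.1 * (2 * t + 1))
      (p.2 * (t + 1) - p.1 * (2 * t + 1)) x y := by
    -- For fixed `n` the segments are `2t + 1` rows apart, so exactly one, `m = q n`, is within `t`
    -- rows of `y`; `r n` is the vertical offset from it.
    let q (n : ℤ) : ℤ := -((y - n * (t + 1) + t) / (2 * t + 1))
    let r (n : ℤ) : ℤ := y - n * (t + 1) + q n * (2 * t + 1)
    have hr (n : ℤ) : -t ≤ r n ∧ r n ≤ t := by
      have h1 := Int.emod_nonneg (y - n * (t + 1) + t) (show 2 * t + 1 ≠ 0 by omega)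
      have h2 := Int.emod_lt_of_pos (y - n * (t + 1) + t) (show 0 < 2 * t + 1 by omega)
      have h3 := Int.emod_add_mul_ediv (y - n * (t + 1) + t) (2 * t + 1)
      have h4 : r n = (y - n * (t + 1) + t) % (2 * t + 1) - t := by
        simp only [r, q]
        linarith
      omega
    have hq (m n : ℤ) (h1 : -t ≤ y - n * (t + 1) + m * (2 * t + 1))
        (h2 : y - n * (t + 1) + m * (2 * t + 1) ≤ t) : m = q n := by
      have h3 := hr n
      simp only [r] at h3
      have h4 : m - q n < 1 := by
        by_contra! h
        nlinarith
      have h5 : -1 < m - q n := by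
        by_contra! h
        nlinarith
      omega
    have hstep (n : ℤ) : (0 < r n → q (n + 1) = q n ∧ r (n + 1) = r n - (t + 1)) ∧
        (r n ≤ 0 → q (n + 1) = q n + 1 ∧ r (n + 1) = r n + t) := by
      have h3 := hr n
      simp only [r] at h3 ⊢
      constructor
      · intro h
        have := hq (q n) (n + 1) (by linarith) (by linarith)
        rw [← this]
        exact ⟨rfl, by ring⟩
      · intro h
        have := hq (q n + 1) (n + 1) (by linarith) (by linarith)
        rw [← this]
        exact ⟨rfl, by ring⟩
    -- Row `y` meets the neighbourhood of tile `(q n, n)` in an interval of length `k + 2 (t - |r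
    -- n|)`, and `g n` is the offset of `x` from its left end. By `hg` the intervals abut.
    let g (n : ℤ) : ℤ := x - (q n + n * (t + k - 1)) + (t - (r n).natAbs)
    have hg (n : ℤ) : g (n + 1) = g n - (k + 2 * (t - (r n).natAbs)) := by
      have h3 := hr n
      have h4 : (n + 1) * (t + k - 1) = n * (t + k - 1) + (t + k - 1) := by ring
      simp only [g, h4]
      rcases lt_or_ge 0 (r n) with h | h
      · obtain ⟨h1, h2⟩ := (hstep n).1 h
        rw [h1, h2]
        omega
      · obtain ⟨h1, h2⟩ := (hstep n).2 h
        rw [h1, h2]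
        omega
    obtain ⟨n, ⟨hn, hn'⟩, huniq⟩ := existsUnique_sign_change (g := g)
      (fun n => by have := hr n; have := hg n; omega)
    refine ⟨(q n, n), ?_, ?_⟩
    · have h3 := hr n
      rw [hg] at hn'
      simp only [g, r, NearBox] at *
      omega
    · rintro ⟨m, n'⟩ h
      simp only at h
      obtain rfl : m = q n' := by
        apply hq <;> unfold NearBox at h <;> omega
      obtain rfl : n' = n := by
        apply huniq
        have h3 := hr n'
        rw [hg]
        simp only [g, r, NearBox] at *
        omega
      rfl
  refine ⟨fun p => by omega, fun p => le_rfl, fun x y => (key x y).exists, ?_⟩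
  intro x y p p' h h'
  exact (key x y).unique h h'

/-- The tiling by neighbourhoods of vertical strips of width `2`. -/
lemma boxTiling_strip {t k : ℤ} (ht : 1 ≤ t) (hk : 1 ≤ k) :
    BoxTiling t (fun p : ℤ × ℤ => (2 * p.1 + p.2) * (t + 1))
      (fun p => (2 * p.1 + p.2) * (t + 1) + 1)
      (fun p => p.2 * (t + k)) (fun p => p.2 * (t + k) + (k - 1)) := by
  have key (x y : ℤ) : ∃! p : ℤ × ℤ, NearBox t ((2 * p.1 + p.2) * (t + 1))
      ((2 * p.1 + p.2) * (t + 1) + 1) (p.2 * (t + k)) (p.2 * (t + k) + (k - 1)) x y := by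
    -- The same scheme with columns for rows: for fixed `n` the neighbourhoods are `2 (t + 1)` wide
    -- and have that period.
    let q (n : ℤ) : ℤ := (x - n * (t + 1) + t) / (2 * (t + 1))
    let r (n : ℤ) : ℤ := x - (2 * q n + n) * (t + 1)
    have hr (n : ℤ) : -t ≤ r n ∧ r n ≤ t + 1 := by
      have h1 := Int.emod_nonneg (x - n * (t + 1) + t) (show 2 * (t + 1) ≠ 0 by omega)
      have h2 := Int.emod_lt_of_pos (x - n * (t + 1) + t) (show 0 < 2 * (t + 1) by omega)
      have h3 := Int.emod_add_mul_ediv (x - n * (t + 1) + t) (2 * (t + 1))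
      have h4 : r n = (x - n * (t + 1) + t) % (2 * (t + 1)) - t := by
        simp only [r, q]
        linarith
      omega
    have hq (m n : ℤ) (h1 : -t ≤ x - (2 * m + n) * (t + 1))
        (h2 : x - (2 * m + n) * (t + 1) ≤ t + 1) : m = q n := by
      have h3 := hr n
      simp only [r] at h3
      have h4 : m - q n < 1 := by
        by_contra! h
        nlinarith
      have h5 : -1 < m - q n := by
        by_contra! h
        nlinarith
      omega
    have hstep (n : ℤ) : (0 < r n → r (n + 1) = r n - (t + 1)) ∧
        (r n ≤ 0 → r (n + 1) = r n + (t + 1)) := by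
      have h3 := hr n
      simp only [r] at h3 ⊢
      constructor
      · intro h
        have := hq (q n) (n + 1) (by linarith) (by linarith)
        rw [← this]
        ring
      · intro h
        have := hq (q n - 1) (n + 1) (by linarith) (by linarith)
        rw [← this]
        ring
    -- The horizontal distance from column `x` to the strip is `max (-r n) (r n - 1)`, never
    -- negative for integral `r n`; the slice extends `s n` beyond the strip at both ends.
    let s (n : ℤ) : ℤ := t - max (-r n) (r n - 1)
    let g (n : ℤ) : ℤ := y - n * (t + k) + s n
    have hs (n : ℤ) : 0 ≤ s n := by have := hr n; simp only [s]; omega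
    have hg (n : ℤ) : g (n + 1) = g n - (k + 2 * s n) := by
      have h3 := hr n
      have h4 : (n + 1) * (t + k) = n * (t + k) + (t + k) := by ring
      simp only [g, s, h4]
      rcases lt_or_ge 0 (r n) with h | h
      · rw [(hstep n).1 h]
        omega
      · rw [(hstep n).2 h]
        omega
    obtain ⟨n, ⟨hn, hn'⟩, huniq⟩ := existsUnique_sign_change (g := g)
      (fun n => by have := hs n; have := hg n; omega)
    refine ⟨(q n, n), ?_, ?_⟩
    · have h3 := hr n
      rw [hg] at hn'
      simp only [g, s, r, NearBox] at *
      omega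
    · rintro ⟨m, n'⟩ h
      simp only at h
      obtain rfl : m = q n' := by
        apply hq <;> unfold NearBox at h <;> omega
      obtain rfl : n' = n := by
        apply huniq
        have h3 := hr n'
        rw [hg]
        simp only [g, s, r, NearBox] at *
        omega
      rfl
  refine ⟨fun p => by omega, fun p => by omega, fun x y => (key x y).exists, ?_⟩
  intro x y p p' h h'
  exact (key x y).unique h h'

/-! ### From tilings to perfect distance-dominating sets. -/

lemma nearBox_iff {t : ℕ} {a b c d : ℤ} (hab : a ≤ b) (hcd : c ≤ d) {v : Fin 2 → ℤ} :
    NearBox t a b c d (v 0) (v 1) ↔ ∃ w ∈ latticeBox a b c d, taxi v w ≤ t := by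
  constructor
  · intro h
    refine ⟨![max a (min b (v 0)), max c (min d (v 1))], ?_, ?_⟩
    · simp [mem_latticeBox, hab, hcd]
    · unfold NearBox at h
      simp only [taxi, Matrix.cons_val_zero, Matrix.cons_val_one]
      omega
  · rintro ⟨w, hw, h⟩
    rw [mem_latticeBox] at hw
    unfold NearBox
    unfold taxi at h
    omega

/-- The nearest point is obtained by clamping each coordinate separately. -/
lemma existsUnique_nearest {a b c d : ℤ} (hab : a ≤ b) (hcd : c ≤ d) (v : Fin 2 → ℤ) :
    ∃! w, w ∈ latticeBox a b c d ∧ ∀ u ∈ latticeBox a b c d, taxi v w ≤ taxi v u := by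
  refine ⟨![max a (min b (v 0)), max c (min d (v 1))], ⟨?_, fun u hu => ?_⟩, fun w hw => ?_⟩
  · simp [mem_latticeBox, hab, hcd]
  · rw [mem_latticeBox] at hu
    simp only [taxi, Matrix.cons_val_zero, Matrix.cons_val_one]
    omega
  · have h1 := hw.1
    have h2 := hw.2 ![max a (min b (v 0)), max c (min d (v 1))]
      (by simp [mem_latticeBox, hab, hcd])
    rw [mem_latticeBox] at h1
    apply eq_of_taxi_eq_zero
    simp only [taxi, Matrix.cons_val_zero, Matrix.cons_val_one] at h2 ⊢
    omega

lemma BoxTiling.componentVerts_eq {ι : Type*} {t : ℕ} {a b c d : ι → ℤ}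
    (h : BoxTiling t a b c d) (ht : 1 ≤ t)
    (C : ((latticeGraph 2).induce
      {v | ∃ i, v ∈ latticeBox (a i) (b i) (c i) (d i)}).ConnectedComponent) :
    ∃ i, componentVerts C = latticeBox (a i) (b i) (c i) (d i) := by
  obtain ⟨⟨v, i, hv⟩, rfl⟩ := C.exists_rep
  refine ⟨i, Set.ext fun w => ⟨?_, fun hw => ?_⟩⟩
  · rintro ⟨w, hw, rfl⟩
    obtain ⟨p⟩ := (ConnectedComponent.eq.1 hw).symm
    by_contra hwi
    obtain ⟨⟨⟨x, y⟩, hadj⟩, -, hx, hy⟩ := p.exists_boundary_dart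
      {x | x.1 ∈ latticeBox (a i) (b i) (c i) (d i)} hv hwi
    obtain ⟨j, hj⟩ := y.2
    have hadj : taxi x y = 1 := latticeGraph_two_adj.1 hadj
    -- An edge leaving box `i` inside the union would end in a box `j`; as `1 ≤ t`, its starting
    -- point is near both.
    obtain rfl : i = j := h.unique (x.1 0) (x.1 1) i j
      ((nearBox_iff (h.left_le i) (h.low_le i)).2 ⟨x, hx, by simp [taxi]⟩)
      ((nearBox_iff (h.left_le j) (h.low_le j)).2 ⟨y, hj, by omega⟩)
    exact hy hj
  · refine ⟨⟨w, i, hw⟩, ?_, rfl⟩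
    have := (connected_induce_latticeBox (h.left_le i) (h.low_le i)).preconnected ⟨w, hw⟩ ⟨v, hv⟩
    exact ConnectedComponent.sound (this.map ((latticeGraph 2).induceHomOfLE
      (fun x hx => (⟨i, hx⟩ : ∃ i, x ∈ latticeBox (a i) (b i) (c i) (d i)))).toHom)

/-- The union of the rectangles of a tiling by neighbourhoods is a perfect distance-dominating
set. -/
theorem BoxTiling.isPDDSOf {ι : Type*} {t : ℕ} {a b c d : ι → ℤ}
    (h : BoxTiling t a b c d) (ht : 1 ≤ t) {m n : ℕ} (hm : ∀ i, b i + 1 - a i = m)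
    (hn : ∀ i, d i + 1 - c i = n) {W : Type*} {H : SimpleGraph W}
    (e : H ≃g pathGraph m □ pathGraph n) :
    IsPDDSOf t H (latticeGraph 2) {v | ∃ i, v ∈ latticeBox (a i) (b i) (c i) (d i)} := by
  refine ⟨fun v => ?_, fun C => ?_⟩
  · obtain ⟨i, hi⟩ := h.exists_near (v 0) (v 1)
    obtain ⟨w, hw, hvw⟩ := (nearBox_iff (h.left_le i) (h.low_le i)).1 hi
    let C := ((latticeGraph 2).induce
      {v | ∃ i, v ∈ latticeBox (a i) (b i) (c i) (d i)}).connectedComponentMk ⟨w, i, hw⟩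
    have hwC : w ∈ componentVerts C := ⟨⟨w, i, hw⟩, rfl, rfl⟩
    refine ⟨C, ⟨vertexSetDist_le_iff.2 ⟨w, hwC, hvw⟩, fun C' hC' => ?_⟩, ?_⟩
    · obtain ⟨j, hj⟩ := h.componentVerts_eq ht C'
      obtain ⟨w', hw', hvw'⟩ := vertexSetDist_le_iff.1 hC'
      obtain rfl := h.unique (v 0) (v 1) i j hi
        ((nearBox_iff (h.left_le j) (h.low_le j)).2 ⟨w', hj ▸ hw', hvw'⟩)
      rw [← hj] at hw
      obtain ⟨x, hx, rfl⟩ := hw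
      exact hx.symm
    · obtain ⟨j, hj⟩ := h.componentVerts_eq ht C
      refine (existsUnique_congr fun u => ?_).2 (existsUnique_nearest (h.left_le j) (h.low_le j) v)
      rw [hj]
      exact and_congr_right fun hu => edist_eq_vertexSetDist_iff hu
  · obtain ⟨i, hi⟩ := h.componentVerts_eq ht C
    rw [hi]
    exact ⟨(latticeBoxIso (hm i) (hn i)).trans e.symm⟩

/-! ### Components of a perfect distance-dominating set. -/

section Structure

variable {t : ℕ} {S : Set (Fin 2 → ℤ)}

/-- Connectedness in the form needed by `eq_latticeBox_of_corner_closed`. -/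
lemma exists_taxi_eq_one_of_mem_componentVerts
    {C : ((latticeGraph 2).induce S).ConnectedComponent} {R : Set (Fin 2 → ℤ)}
    (hR : R ⊆ componentVerts C) (hne : R.Nonempty) (hRC : R ≠ componentVerts C) :
    ∃ u ∈ R, ∃ v ∈ componentVerts C, v ∉ R ∧ taxi u v = 1 := by
  obtain ⟨r, hr⟩ := hne
  obtain ⟨_, ⟨w, hw, rfl⟩, hwR⟩ := Set.exists_of_ssubset (hR.ssubset_of_ne hRC)
  obtain ⟨x, hx, rfl⟩ := hR hr
  obtain ⟨p⟩ := ConnectedComponent.eq.1 (hx.trans hw.symm)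
  obtain ⟨⟨⟨x, y⟩, hadj⟩, -, hxR, hyR⟩ := p.exists_boundary_dart {x | x.1 ∈ R} hr hwR
  refine ⟨x, hxR, y, ⟨y, ?_, rfl⟩, hyR, latticeGraph_two_adj.1 hadj⟩
  obtain ⟨x', hx', hxx'⟩ := hR hxR
  obtain rfl := Subtype.ext hxx'
  exact (C.mem_supp_congr_adj hadj).1 hx'

lemma IsPDDS.eq_of_near (h : IsPDDS t (latticeGraph 2) S)
    {C C' : ((latticeGraph 2).induce S).ConnectedComponent} (v : Fin 2 → ℤ)
    (hC : ∃ w ∈ componentVerts C, taxi v w ≤ t) (hC' : ∃ w ∈ componentVerts C', taxi v w ≤ t) :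
    C = C' := by
  obtain ⟨D, ⟨-, hD⟩, -⟩ := h v
  rw [hD C (vertexSetDist_le_iff.2 hC), hD C' (vertexSetDist_le_iff.2 hC')]

/-- A vertex with two neighbours in a component belongs to this component. -/
lemma IsPDDS.mem_of_two_neighbors (h : IsPDDS t (latticeGraph 2) S) (ht : 1 ≤ t)
    {C : ((latticeGraph 2).induce S).ConnectedComponent} {v w w' : Fin 2 → ℤ}
    (hw : w ∈ componentVerts C) (hw' : w' ∈ componentVerts C) (hne : w ≠ w')
    (hvw : taxi v w = 1) (hvw' : taxi v w' = 1) : v ∈ componentVerts C := by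
  by_contra hv
  obtain ⟨D, ⟨-, hD⟩, huniq⟩ := h v
  obtain rfl := hD C (vertexSetDist_le_iff.2 ⟨w, hw, by omega⟩)
  have hpos : ∀ u ∈ componentVerts C, 1 ≤ taxi v u := by
    intro u hu
    by_contra! h0
    obtain rfl := eq_of_taxi_eq_zero (show taxi v u = 0 by omega)
    exact hv hu
  exact hne (huniq.unique ⟨hw, (edist_eq_vertexSetDist_iff hw).2 (hvw ▸ hpos)⟩
    ⟨hw', (edist_eq_vertexSetDist_iff hw').2 (hvw' ▸ hpos)⟩)

/-- The finite components of a perfect distance-dominating set are rectangles. -/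
lemma IsPDDS.exists_componentVerts_eq_latticeBox (h : IsPDDS t (latticeGraph 2) S) (ht : 1 ≤ t)
    (C : ((latticeGraph 2).induce S).ConnectedComponent) (hfin : (componentVerts C).Finite) :
    ∃ a b c d : ℤ, a ≤ b ∧ c ≤ d ∧ componentVerts C = latticeBox a b c d := by
  refine eq_latticeBox_of_corner_closed hfin (C.nonempty_supp.image _)
    (fun R hR hne hRC => exists_taxi_eq_one_of_mem_componentVerts hR hne hRC) ?_
  intro x y x' y' hx hy h1 h2
  refine h.mem_of_two_neighbors ht h1 h2 (fun heq => ?_) ?_ ?_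
  · have := congrFun heq 0
    simp only [Matrix.cons_val_zero] at this
    omega
  · simp only [taxi, Matrix.cons_val_zero, Matrix.cons_val_one]
    omega
  · simp only [taxi, Matrix.cons_val_zero, Matrix.cons_val_one]
    omega

end Structure

/-! ### Side lengths and the classification. -/

/-- Every vertex of the graph has at least two neighbours. -/
def HasTwoNeighbors {V : Type*} (G : SimpleGraph V) : Prop :=
  ∀ v, ∃ u w, u ≠ w ∧ G.Adj v u ∧ G.Adj v w

lemma HasTwoNeighbors.of_iso {V W : Type*} {G : SimpleGraph V} {H : SimpleGraph W}
    (h : HasTwoNeighbors G) (e : G ≃g H) : HasTwoNeighbors H := by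
  intro v
  obtain ⟨u, w, huw, hu, hw⟩ := h (e.symm v)
  refine ⟨e u, e w, e.injective.ne huw, ?_, ?_⟩
  · rwa [← e.symm.map_adj_iff, e.symm_apply_apply]
  · rwa [← e.symm.map_adj_iff, e.symm_apply_apply]

lemma hasTwoNeighbors_latticeBox_iff {a b c d : ℤ} (hab : a ≤ b) (hcd : c ≤ d) :
    HasTwoNeighbors ((latticeGraph 2).induce (latticeBox a b c d)) ↔
      a + 1 ≤ b ∧ c + 1 ≤ d := by
  constructor
  · intro h
    obtain ⟨⟨u, hu⟩, ⟨w, hw⟩, hne, h1, h2⟩ := h ⟨![a, c], by simp [mem_latticeBox, hab, hcd]⟩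
    have h1 : taxi ![a, c] u = 1 := latticeGraph_two_adj.1 h1
    have h2 : taxi ![a, c] w = 1 := latticeGraph_two_adj.1 h2
    have hne : taxi u w ≠ 0 := fun h0 => hne (Subtype.ext (eq_of_taxi_eq_zero h0))
    rw [mem_latticeBox] at hu hw
    simp only [taxi, Matrix.cons_val_zero, Matrix.cons_val_one] at h1 h2 hne
    omega
  · rintro ⟨h1, h2⟩ ⟨v, hv⟩
    rw [mem_latticeBox] at hv
    obtain ⟨x, hx, hx', hxv⟩ : ∃ x, a ≤ x ∧ x ≤ b ∧ (v 0 - x).natAbs = 1 := by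
      by_cases h : v 0 = a
      · exact ⟨a + 1, by omega⟩
      · exact ⟨v 0 - 1, by omega⟩
    obtain ⟨y, hy, hy', hyv⟩ : ∃ y, c ≤ y ∧ y ≤ d ∧ (v 1 - y).natAbs = 1 := by
      by_cases h : v 1 = c
      · exact ⟨c + 1, by omega⟩
      · exact ⟨v 1 - 1, by omega⟩
    refine ⟨⟨![x, v 1], by simp [mem_latticeBox, *]⟩, ⟨![v 0, y], by simp [mem_latticeBox, *]⟩,
      fun h => ?_, latticeGraph_two_adj.2 ?_, latticeGraph_two_adj.2 ?_⟩
    · have := congrFun (congrArg Subtype.val h) 0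
      simp only [Matrix.cons_val_zero] at this
      omega
    · simp [taxi, hxv]
    · simp [taxi, hyv]

theorem corollary1 {W : Type*} [Finite W] (H : SimpleGraph W) (t : ℕ) (ht : 1 ≤ t) :
    (∃ S : Set (Fin 2 → ℤ), IsPDDSOf t H (latticeGraph 2) S) ↔
      (∃ k : ℕ, 1 ≤ k ∧ Nonempty (H ≃g pathGraph k)) ∨
      (∃ k : ℕ, 2 ≤ k ∧ Nonempty (H ≃g pathGraph 2 □ pathGraph k)) := by
  constructor
  · rintro ⟨S, hS, hH⟩
    have hfin (C : ((latticeGraph 2).induce S).ConnectedComponent) :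
        (componentVerts C).Finite := by
      obtain ⟨e⟩ := hH C
      have := Finite.of_equiv W e.symm.toEquiv
      exact Set.toFinite _
    choose a b c d hab hcd hbox using
      fun C => hS.exists_componentVerts_eq_latticeBox ht C (hfin C)
    replace hH (C) : Nonempty
        ((latticeGraph 2).induce (latticeBox (a C) (b C) (c C) (d C)) ≃g H) := hbox C ▸ hH C
    have hT : BoxTiling t a b c d := by
      refine ⟨hab, hcd, fun x y => ?_, fun x y C C' hC hC' => ?_⟩
      · obtain ⟨C, ⟨hC, -⟩, -⟩ := hS ![x, y]
        refine ⟨C, (nearBox_iff (hab C) (hcd C) (v := ![x, y])).2 ?_⟩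
        rw [← hbox]
        exact vertexSetDist_le_iff.1 hC
      · refine hS.eq_of_near ![x, y] ?_ ?_
        · rw [hbox]
          exact (nearBox_iff (hab C) (hcd C) (v := ![x, y])).1 hC
        · rw [hbox]
          exact (nearBox_iff (hab C') (hcd C') (v := ![x, y])).1 hC'
    obtain ⟨C, -⟩ := hS 0
    have hC1 := hab C
    have hC2 := hcd C
    obtain ⟨m, hm⟩ : ∃ m : ℕ, b C + 1 - a C = m := ⟨(b C + 1 - a C).toNat, by omega⟩
    obtain ⟨n, hn⟩ : ∃ n : ℕ, d C + 1 - c C = n := ⟨(d C + 1 - c C).toNat, by omega⟩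
    obtain ⟨e⟩ := hH C
    have e' : H ≃g pathGraph m □ pathGraph n := e.symm.trans (latticeBoxIso hm hn)
    obtain rfl | hn1 := eq_or_ne n 1
    · exact Or.inl ⟨m, by omega, ⟨e'.trans (boxProdPathGraphOne _)⟩⟩
    obtain rfl | hm1 := eq_or_ne m 1
    · exact Or.inl ⟨n, by omega, ⟨(e'.trans (boxProdComm _ _)).trans (boxProdPathGraphOne _)⟩⟩
    obtain rfl | hm2 := eq_or_ne m 2
    · exact Or.inr ⟨n, by omega, ⟨e'⟩⟩
    obtain rfl | hn2 := eq_or_ne n 2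
    · exact Or.inr ⟨m, by omega, ⟨e'.trans (boxProdComm _ _)⟩⟩
    -- `not_three_le` needs sides at least `2` in every rectangle. This property is read off from
    -- the isomorphism type, so it passes from `C` to all components without comparing side lengths.
    have htwo : HasTwoNeighbors H :=
      ((hasTwoNeighbors_latticeBox_iff hC1 hC2).2 (by omega)).of_iso e
    have hsize (D) : a D + 1 ≤ b D ∧ c D + 1 ≤ d D := by
      obtain ⟨f⟩ := hH D
      exact (hasTwoNeighbors_latticeBox_iff (hab D) (hcd D)).1 (htwo.of_iso f.symm)
    exact (hT.not_three_le (by omega) (fun D => (hsize D).1) (fun D => (hsize D).2) C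
      (by omega) (by omega)).elim
  · rintro (⟨k, hk, ⟨e⟩⟩ | ⟨k, hk, ⟨e⟩⟩)
    · have hT := boxTiling_segment (t := t) (k := k) (by omega) (by omega)
      exact ⟨_, hT.isPDDSOf ht (m := k) (n := 1) (fun i => by omega) (fun i => by omega)
        (e.trans (boxProdPathGraphOne _).symm)⟩
    · have hT := boxTiling_strip (t := t) (k := k) (by omega) (by omega)
      exact ⟨_, hT.isPDDSOf ht (m := 2) (n := k) (fun i => by omega) (fun i => by omega) e⟩
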